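/- A plane partition is a finite set $\mathcal{P}$ of points $(i,j,k)$ with positive integer coordinates such that, if $(r,s,t)\in\mathcal{P}$ and $1\le i\le r$, $1\le j\le s$, $1\le k\le t$, then $(i,j,k)\in\mathcal{P}$. It is symmetric if $(i,j,k)\in\mathcal{P}$ if and only if $(j,i,k)\in\mathcal{P}$. For all integers $n,m\ge 0$, let $\mathcal{S}_{n,m}$ be the finite set of all symmetric plane partitions $\mathcal{P}$ such that $i\le n$, $j\le n$ and $k\le m$ for every $(i,j,k)\in\mathcal{P}$. Then, as an identity of rational functions in $\mathbb{Q}(q)$, $$\sum_{\mathcal{P}\in\mathcal{S}_{n,m}} q^{|\mathcal{P}|}=\prod_{i=1}^n\frac{1-q^{m+2i-1}}{1-q^{2i-1}}\prod_{1\le i<j\le n}\frac{1-q^{2(m+i+j-1)}}{1-q^{2(i+j-1)}},$$ where $|\mathcal{P}|$ is the number of points of $\mathcal{P}$. -/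

import Mathlib

/-- A plane partition: a finite set of points of `ℕ³` with positive coordinates that contains,
with each point `(r, s, t)`, every `(i, j, k)` with `1 ≤ i ≤ r`, `1 ≤ j ≤ s`, `1 ≤ k ≤ t`. -/
def IsPlanePartition (P : Finset (ℕ × ℕ × ℕ)) : Prop :=
  (∀ i j k : ℕ, (i, j, k) ∈ P → 1 ≤ i ∧ 1 ≤ j ∧ 1 ≤ k) ∧
  ∀ r s t : ℕ, (r, s, t) ∈ P → ∀ i j k : ℕ,
    1 ≤ i → i ≤ r → 1 ≤ j → j ≤ s → 1 ≤ k → k ≤ t → (i, j, k) ∈ P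

/-- Invariance under exchanging the first two coordinates. -/
def IsSymmetricPlanePartition (P : Finset (ℕ × ℕ × ℕ)) : Prop :=
  IsPlanePartition P ∧ ∀ i j k : ℕ, (i, j, k) ∈ P ↔ (j, i, k) ∈ P

open Classical in
/-- The finite set of all symmetric plane partitions with `x, y ≤ n` and `z ≤ m`. -/
noncomputable def boundedSymmetricPlanePartitions (n m : ℕ) : Finset (Finset (ℕ × ℕ × ℕ)) :=
  (Finset.Icc 1 n ×ˢ Finset.Icc 1 n ×ˢ Finset.Icc 1 m).powerset.filter IsSymmetricPlanePartition

/-- Membership in `boundedSymmetricPlanePartitions`, without reference to an ambient box. -/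
theorem mem_boundedSymmetricPlanePartitions (n m : ℕ) (P : Finset (ℕ × ℕ × ℕ)) :
    P ∈ boundedSymmetricPlanePartitions n m ↔
      IsSymmetricPlanePartition P ∧
        ∀ i j k : ℕ, (i, j, k) ∈ P → i ≤ n ∧ j ≤ n ∧ k ≤ m := by
  simp only [boundedSymmetricPlanePartitions, Finset.mem_filter, Finset.mem_powerset]
  constructor
  · rintro ⟨h, hP⟩
    refine ⟨hP, fun i j k hp => ?_⟩
    have := h hp
    simp only [Finset.mem_product, Finset.mem_Icc] at this
    omega
  · rintro ⟨hP, h⟩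
    refine ⟨?_, hP⟩
    rintro ⟨i, j, k⟩ hp
    have h1 := h i j k hp
    have h2 := hP.1.1 i j k hp
    simp only [Finset.mem_product, Finset.mem_Icc]
    omega

/-- The generating function of the symmetric plane partitions with `x, y ≤ n` and `z ≤ m`,
by number of points, as an element of the field `ℚ(q)`. -/
noncomputable def symmetricPlanePartitionGF (n m : ℕ) : RatFunc ℚ :=
  ∑ P ∈ boundedSymmetricPlanePartitions n m, (RatFunc.X : RatFunc ℚ) ^ P.card

/-! Deleting the diagonal of a symmetric plane partition and closing up the halves leaves a smaller
one whose diagonal interlaces the deleted one. This gives a recursion for the generating function of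
the partitions with diagonal λ (`diagonalGF_succ`). Vandermonde determinants in powers of q^2 obey
the matching summation rule (`sum_det_interlacing_partition`), so the generating function is the
Schur function s_λ(q, q^3, …, q^(2n-1)) (`diagonalGF_mul_powVandermonde`).

It remains to sum s_λ over all λ with at most n parts, each at most m. The bounded Littlewood
identity `alternantSum_mul_prod` expresses this sum, cleared of denominators, through
det(x_j^(m+2n-1-i) - x_j^i). It is proved by induction on n and the bound, with
`det_cons_reflect_identity` as the inductive step.

At x_j = q^(2j+1) the entries are a_i^(2j+1) - b_i^(2j+1) with a_i b_i independent of i, so the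
determinant reduces to a Vandermonde in a_i^2 + b_i^2 and factors completely
(`det_reflect_odd_powers`). -/

/-! ### A linear relation between reflected determinants. -/

/-- Determinant with rows `w, g 0 + g 1, g 1 + g 2, …`, as a linear function of `w`. -/
noncomputable def detConsPairSum {R : Type*} [CommRing R] {n : ℕ} (g : ℕ → Fin (n + 1) → R) :
    (Fin (n + 1) → R) →ₗ[R] R :=
  Matrix.detRowAlternating.toMultilinearMap.toLinearMap
    (Fin.cons 0 fun i : Fin n => g i + g (i + 1)) 0

theorem detConsPairSum_apply {R : Type*} [CommRing R] {n : ℕ} (g : ℕ → Fin (n + 1) → R)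
    (w : Fin (n + 1) → R) :
    detConsPairSum g w =
      (Matrix.of (Fin.cons w fun i : Fin n => g i + g (i + 1) : Fin (n + 1) → Fin (n + 1) → R)).det := by
  simp only [detConsPairSum, MultilinearMap.toLinearMap_apply]
  rw [Fin.update_cons_zero]
  rfl

theorem detConsPairSum_zero {R : Type*} [CommRing R] {n : ℕ} (g : ℕ → Fin (n + 1) → R) :
    detConsPairSum g (g 0) = (Matrix.of fun i : Fin (n + 1) => g i).det := by
  rw [detConsPairSum_apply]
  symm
  apply Matrix.det_eq_of_forall_row_eq_smul_add_pred (fun _ => -1)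
  · intro j; simp
  · intro i j; simp

/-- The row `g i + g (i + 1)` already occurs below, so placing it on top gives determinant zero. -/
theorem detConsPairSum_succ {R : Type*} [CommRing R] {n : ℕ} (g : ℕ → Fin (n + 1) → R)
    (i : ℕ) (hi : i < n) : detConsPairSum g (g (i + 1)) = -detConsPairSum g (g i) := by
  have : detConsPairSum g (g i + g (i + 1)) = 0 := by
    rw [detConsPairSum_apply]
    apply Matrix.det_zero_of_row_eq (i := 0) (j := Fin.succ ⟨i, hi⟩) (Fin.succ_ne_zero _).symm
    simp
    rfl
  rw [map_add] at this
  linear_combination this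

theorem detConsPairSum_self {R : Type*} [CommRing R] {n : ℕ} (g : ℕ → Fin (n + 1) → R)
    (i : ℕ) (hi : i ≤ n) :
    detConsPairSum g (g i) = (-1) ^ i * (Matrix.of fun i : Fin (n + 1) => g i).det := by
  induction i with
  | zero => simp [detConsPairSum_zero]
  | succ i ih => rw [detConsPairSum_succ g i hi, ih (by omega), pow_succ]; ring

/-- Multiplying column k by 1 + x_k turns row i into h_i + h_(i+1), where h_i = x^(L+1-i) - x^i: the
shape of `detConsPairSum`. The coefficients of R(t) = ∏(1 - x_j t) relate the h_i up to the term
R(x_k), which `v` absorbs, and R(-1) = ∏(1 + x_k) is exactly the factor introduced. -/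
theorem det_cons_reflect_identity {K : Type*} [Field K] {n : ℕ} (x : Fin (n + 1) → K)
    (hx : ∀ k, x k ≠ 0) (hx1 : ∀ k, 1 + x k ≠ 0) (L : ℕ) (hL : n ≤ L)
    (v : Fin (n + 1) → K) (hv : ∀ k, (1 + x k) * v k = -∏ j, (1 - x k * x j)) :
    (Matrix.of fun i k : Fin (n + 1) => x k ^ (L - i) - x k ^ (i : ℕ)).det =
      (Matrix.of fun i k : Fin (n + 1) => x k ^ (L - i) - x k ^ (i + 1 : ℕ)).det +
      (Matrix.of (Fin.cons v fun (i : Fin n) k => x k ^ (L - (i + 1)) - x k ^ (i + 1 : ℕ) :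
        Fin (n + 1) → Fin (n + 1) → K)).det := by
  classical
  set R : Polynomial K := ∏ j, (1 - Polynomial.C (x j) * Polynomial.X) with hR
  have hdeg : R.natDegree < n + 2 := by
    have : R.natDegree ≤ ∑ j : Fin (n + 1), 1 := by
      refine (Polynomial.natDegree_prod_le _ _).trans (Finset.sum_le_sum fun j _ => ?_)
      compute_degree
    simp at this
    omega
  have hev : ∀ t, R.eval t = ∏ j, (1 - t * x j) := by
    intro t
    rw [hR, Polynomial.eval_prod]
    exact Finset.prod_congr rfl fun j _ => by simp; ring
  have hsum : ∀ t, R.eval t = ∑ i ∈ Finset.range (n + 2), R.coeff i * t ^ i := fun t =>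
    Polynomial.eval_eq_sum_range' hdeg t
  have hc0 : R.coeff 0 = 1 := by
    rw [Polynomial.coeff_zero_eq_eval_zero, hev]; simp
  let h : ℕ → Fin (n + 1) → K := fun i k => x k ^ (L + 1 - i) - x k ^ i
  let g : ℕ → Fin (n + 1) → K := fun i => h (i + 1)
  have hrel : ∀ k, ∑ i ∈ Finset.range (n + 2), R.coeff i * h i k = -∏ j, (1 - x k * x j) := by
    intro k
    -- This is R(1/x_k) = 0 multiplied by x_k^(L+1).
    have h1 : ∑ i ∈ Finset.range (n + 2), R.coeff i * x k ^ (L + 1 - i) = 0 := by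
      have h2 : R.eval (x k)⁻¹ = 0 := by
        rw [hev]
        exact Finset.prod_eq_zero (Finset.mem_univ k) (by rw [inv_mul_cancel₀ (hx k), sub_self])
      rw [hsum] at h2
      have := congrArg (x k ^ (L + 1) * ·) h2
      simp only [mul_zero, Finset.mul_sum] at this
      rw [← this]
      refine Finset.sum_congr rfl fun i hi => ?_
      have hi' : i ≤ L + 1 := by have := Finset.mem_range.1 hi; omega
      rw [pow_sub₀ _ (hx k) hi', inv_pow]
      ring
    simp only [h, mul_sub, Finset.sum_sub_distrib, h1, ← hev, hsum, zero_sub]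
  have hf : ∀ i ≤ L, ∀ k, (1 + x k) * (x k ^ (L - i) - x k ^ i) = h i k + h (i + 1) k := by
    intro i hi k
    simp only [h]
    rw [show L + 1 - i = (L - i) + 1 by omega, show L + 1 - (i + 1) = L - i by omega]
    ring
  have hprod : ∏ k, (1 + x k) ≠ 0 := Finset.prod_ne_zero_iff.2 fun k _ => hx1 k
  -- As R has constant term 1, the relation trades h_0 for h_1, …, h_(n+1), that is, for the rows of
  -- `g`.
  have hw : (fun k => h 0 k + h 1 k + ∏ j, (1 - x k * x j)) =
      g 0 - ∑ i ∈ Finset.range (n + 1), R.coeff (i + 1) • g i := by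
    ext k
    have := hrel k
    rw [Finset.sum_range_succ', hc0] at this
    simp only [Pi.sub_apply, Finset.sum_apply, Pi.smul_apply, smul_eq_mul, g]
    linear_combination this
  have key := congrArg (detConsPairSum g) hw
  rw [map_sub, map_sum, detConsPairSum_zero] at key
  -- The values at `g i` alternate in sign, so the sum collects 1 - R(-1).
  have key2 : ∑ i ∈ Finset.range (n + 1), detConsPairSum g (R.coeff (i + 1) • g i) =
      (1 - ∏ k, (1 + x k)) * (Matrix.of fun i : Fin (n + 1) => g i).det := by
    have : ∏ k, (1 + x k) = R.eval (-1) := by rw [hev]; simp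
    rw [this, hsum, Finset.sum_range_succ' (fun i => R.coeff i * (-1) ^ i), hc0]
    rw [pow_zero, mul_one, sub_add_cancel_right, ← Finset.sum_neg_distrib, Finset.sum_mul]
    refine Finset.sum_congr rfl fun i hi => ?_
    rw [map_smul, detConsPairSum_self g i (by have := Finset.mem_range.1 hi; omega), smul_eq_mul]
    ring
  rw [key2] at key
  have hg : (Matrix.of fun i k : Fin (n + 1) => x k ^ (L - i) - x k ^ (i + 1 : ℕ)) =
      Matrix.of fun i : Fin (n + 1) => g i := by
    ext i k
    simp [g, h]
  have hcons : detConsPairSum g (fun k => h 0 k + h 1 k + ∏ j, (1 - x k * x j)) =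
      (∏ k, (1 + x k)) * (Matrix.of (Fin.cons (fun k => (x k ^ L - 1) - v k) fun (i : Fin n) k =>
        x k ^ (L - (i + 1)) - x k ^ (i + 1 : ℕ) : Fin (n + 1) → Fin (n + 1) → K)).det := by
    rw [detConsPairSum_apply, ← Matrix.det_mul_row]
    congr 1
    ext i k
    refine Fin.cases ?_ (fun i => ?_) i
    · have := hf 0 (by omega) k
      simp only [Matrix.of_apply, Fin.cons_zero] at *
      rw [mul_sub, hv, ← this]
      simp
    · simp only [Matrix.of_apply, Fin.cons_succ, Pi.add_apply, g]
      rw [hf (i + 1) (by omega) k]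
  -- Only row 0 differs: x^L - 1 is split as (x^L - 1 - v) + v.
  have hsplit : (Matrix.of fun i k : Fin (n + 1) => x k ^ (L - i) - x k ^ (i : ℕ)).det =
      (Matrix.of (Fin.cons (fun k => (x k ^ L - 1) - v k) fun (i : Fin n) k =>
        x k ^ (L - (i + 1)) - x k ^ (i + 1 : ℕ) : Fin (n + 1) → Fin (n + 1) → K)).det +
      (Matrix.of (Fin.cons v fun (i : Fin n) k => x k ^ (L - (i + 1)) - x k ^ (i + 1 : ℕ) :
        Fin (n + 1) → Fin (n + 1) → K)).det := by
    have hz : ∀ w : Fin (n + 1) → K, (Matrix.of (Fin.cons w fun (i : Fin n) k =>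
        x k ^ (L - (i + 1)) - x k ^ (i + 1 : ℕ) : Fin (n + 1) → Fin (n + 1) → K)) =
        (Matrix.of fun i k : Fin (n + 1) => x k ^ (L - i) - x k ^ (i : ℕ)).updateRow 0 w := by
      intro w
      ext i k
      refine Fin.cases ?_ (fun i => ?_) i
      · simp
      · simp [Matrix.updateRow_ne]
    rw [hz, hz, ← Matrix.det_updateRow_add]
    congr 1
    ext i k
    refine Fin.cases ?_ (fun i => ?_) i
    · simp
    · simp [Matrix.updateRow_ne]
  rw [hsplit, hg]
  congr 1
  apply mul_left_cancel₀ hprod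
  rw [← hcons, key]
  ring

/-! ### The bounded Littlewood identity. -/

theorem prod_Ioi_eq_prod_succAbove {R : Type*} [CommMonoid R] {n : ℕ}
    (F : Fin (n + 1) → Fin (n + 1) → R) (hF : ∀ i j, F i j = F j i) (k : Fin (n + 1)) :
    ∏ i, ∏ j ∈ Finset.Ioi i, F i j =
      (∏ j, F k (k.succAbove j)) *
        ∏ i, ∏ j ∈ Finset.Ioi i, F (k.succAbove i) (k.succAbove j) := by
  classical
  have h : ∀ {m : ℕ} (G : Fin m → Fin m → R),
      ∏ i, ∏ j ∈ Finset.Ioi i, G i j = ∏ i, ∏ j, if i < j then G i j else 1 := by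
    intro m G
    refine Finset.prod_congr rfl fun i _ => ?_
    rw [← Finset.prod_filter]
    congr 1
    ext j
    simp
  rw [h, h, Fin.prod_univ_succAbove _ k, Fin.prod_univ_succAbove _ k]
  simp_rw [fun i => Fin.prod_univ_succAbove
    (fun j => if k.succAbove i < j then F (k.succAbove i) j else 1) k]
  rw [Finset.prod_mul_distrib, ← mul_assoc]
  simp only [lt_irrefl, if_false, one_mul, Fin.succAbove_lt_succAbove_iff]
  congr 1
  rw [← Finset.prod_mul_distrib]
  refine Finset.prod_congr rfl fun j _ => ?_
  rcases lt_or_gt_of_ne (Fin.succAbove_ne k j) with hlt | hlt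
  · rw [if_neg hlt.not_gt, if_pos hlt, one_mul, hF]
  · rw [if_pos hlt, if_neg hlt.not_gt, mul_one]

open Classical in
/-- Weakly increasing `n`-tuples of natural numbers less than `M`. -/
noncomputable def monotoneTuples (n M : ℕ) : Finset (Fin n → ℕ) :=
  (Fintype.piFinset fun _ => Finset.range M).filter Monotone

theorem mem_monotoneTuples {n M : ℕ} {l : Fin n → ℕ} :
    l ∈ monotoneTuples n M ↔ (∀ i, l i < M) ∧ Monotone l := by
  simp [monotoneTuples]

/-- The sum of the alternants `det (x_j ^ (l_i + i))` over weakly increasing tuples `l < M`. -/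
noncomputable def alternantSum {K : Type*} [CommRing K] (n M : ℕ) (x : Fin n → K) : K :=
  ∑ l ∈ monotoneTuples n M, (Matrix.of fun i j : Fin n => x j ^ (l i + i)).det

theorem monotone_cons_zero {n : ℕ} {l : Fin n → ℕ} (h : Monotone l) :
    Monotone (Fin.cons 0 l : Fin (n + 1) → ℕ) := by
  intro i j hij
  induction i using Fin.cases with
  | zero => simp
  | succ i =>
    induction j using Fin.cases with
    | zero => simp at hij
    | succ j => simpa using h (by simpa using hij)

/-- If l 0 > 0, lowering every l i by one extracts ∏ x_j. If l 0 = 0, the top row consists of ones,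
and the Laplace expansion leaves alternants in n variables with one extra power of each variable. -/
theorem alternantSum_succ {K : Type*} [CommRing K] (n M : ℕ) (x : Fin (n + 1) → K) :
    alternantSum (n + 1) (M + 1) x = (∏ j, x j) * alternantSum (n + 1) M x +
      ∑ k : Fin (n + 1), (-1) ^ (k : ℕ) * (∏ j, x (k.succAbove j)) *
        alternantSum n (M + 1) (fun j => x (k.succAbove j)) := by
  classical
  unfold alternantSum
  rw [← Finset.sum_filter_not_add_sum_filter _ (fun l => l 0 = 0)]
  congr 1
  · rw [Finset.mul_sum]
    symm
    refine Finset.sum_bij' (fun l _ i => l i + 1) (fun l _ i => l i - 1) ?_ ?_ ?_ ?_ ?_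
    · intro l hl
      rw [mem_monotoneTuples] at hl
      rw [Finset.mem_filter, mem_monotoneTuples]
      exact ⟨⟨fun i => by have := hl.1 i; omega, fun i j hij => by have := hl.2 hij; simpa⟩,
        by simp⟩
    · intro l hl
      rw [Finset.mem_filter, mem_monotoneTuples] at hl
      rw [mem_monotoneTuples]
      refine ⟨fun i => ?_, fun i j hij => Nat.sub_le_sub_right (hl.1.2 hij) 1⟩
      have := hl.1.1 i
      have := hl.1.2 (Fin.zero_le i)
      have := hl.2
      omega
    · intro l hl; simp
    · intro l hl
      rw [Finset.mem_filter, mem_monotoneTuples] at hl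
      ext i
      have := hl.1.2 (Fin.zero_le i)
      have := hl.2
      dsimp only
      omega
    · intro l hl
      rw [← Matrix.det_mul_row]
      congr 1
      ext i j
      simp only [Matrix.of_apply]
      ring
  · simp_rw [Finset.mul_sum]
    rw [Finset.sum_comm]
    symm
    refine Finset.sum_bij' (fun l _ => (Fin.cons 0 l : Fin (n + 1) → ℕ))
      (fun l _ => Fin.tail l) ?_ ?_ ?_ ?_ ?_
    · intro l hl
      rw [mem_monotoneTuples] at hl
      rw [Finset.mem_filter, mem_monotoneTuples]
      refine ⟨⟨fun i => ?_, monotone_cons_zero hl.2⟩, by simp⟩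
      induction i using Fin.cases with
      | zero => simp
      | succ i => simpa using hl.1 i
    · intro l hl
      rw [Finset.mem_filter, mem_monotoneTuples] at hl
      rw [mem_monotoneTuples]
      exact ⟨fun i => hl.1.1 _, fun i j hij => hl.1.2 (by simpa using hij)⟩
    · intro l hl; simp
    · intro l hl
      rw [Finset.mem_filter, mem_monotoneTuples] at hl
      rw [← hl.2]
      exact Fin.cons_self_tail l
    · intro l hl
      rw [Matrix.det_succ_row_zero]
      refine Finset.sum_congr rfl fun k _ => ?_
      rw [mul_assoc, ← Matrix.det_mul_row]
      simp only [Matrix.of_apply, Fin.cons_zero, Fin.val_zero, add_zero, pow_zero, mul_one]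
      congr 2
      ext i j
      simp only [Matrix.of_apply, Matrix.submatrix_apply, Fin.cons_succ, Fin.val_succ]
      ring

/-- Both sides satisfy the recursion of `alternantSum_succ`; on the determinant side it is
`det_cons_reflect_identity` with row 0 expanded. -/
theorem alternantSum_mul_prod {K : Type*} [Field K] (n : ℕ) : ∀ (M : ℕ) (x : Fin n → K)
    (_ : ∀ k, x k ≠ 0) (_ : ∀ k, 1 + x k ≠ 0),
    alternantSum n M x *
        ((∏ i, (x i - 1)) * ∏ i, ∏ j ∈ Finset.Ioi i, (1 - x i * x j)) =
      (Matrix.of fun i j : Fin n => x j ^ (M + 2 * n - 2 - i) - x j ^ (i : ℕ)).det := by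
  induction n with
  | zero =>
    intro M x _ _
    have : monotoneTuples 0 M = {Fin.elim0} := by
      ext l
      simp [mem_monotoneTuples, Subsingleton.elim l Fin.elim0, Subsingleton.monotone]
    simp [alternantSum, this]
  | succ n ihn =>
    intro M x hx hx1
    induction M with
    | zero =>
      have : monotoneTuples (n + 1) 0 = ∅ := by
        ext l
        simp [mem_monotoneTuples]
      rw [alternantSum, this, Finset.sum_empty, zero_mul]
      symm
      apply Matrix.det_eq_zero_of_row_eq_zero (Fin.last n)
      intro j
      simp only [Matrix.of_apply, Fin.val_last]
      rw [show 0 + 2 * (n + 1) - 2 - n = n by omega, sub_self]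
    | succ M ihM =>
      rw [alternantSum_succ, add_mul, mul_assoc, ihM, Finset.sum_mul]
      -- This `v` consists of the factors of the left-hand product that involve x_k; times 1 + x_k
      -- it supplies the missing j = k factor, up to sign.
      have hid := det_cons_reflect_identity x hx hx1 (M + 2 * n + 1) (by omega)
        (fun k => (x k - 1) * ∏ j, (1 - x k * x (k.succAbove j))) (by
          intro k
          rw [Fin.prod_univ_succAbove _ k]
          ring)
      have e1 : M + 1 + 2 * (n + 1) - 2 = M + 2 * n + 1 := by omega
      rw [e1, hid]
      congr 1
      · rw [← Matrix.det_mul_row]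
        congr 1
        ext i j
        simp only [Matrix.of_apply]
        rw [show M + 2 * n + 1 - (i : ℕ) = (M + 2 * (n + 1) - 2 - i) + 1 by omega]
        ring
      · rw [Matrix.det_succ_row_zero]
        refine Finset.sum_congr rfl fun k _ => ?_
        have h := ihn (M + 1) (fun j => x (k.succAbove j)) (fun j => hx _) (fun j => hx1 _)
        rw [prod_Ioi_eq_prod_succAbove (fun i j => 1 - x i * x j)
          (fun i j => by rw [mul_comm]) k, Fin.prod_univ_succAbove _ k]
        have h2 : (∏ j, x (k.succAbove j)) * (Matrix.of fun i j : Fin n =>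
            x (k.succAbove j) ^ (M + 1 + 2 * n - 2 - i) - x (k.succAbove j) ^ (i : ℕ)).det =
            (Matrix.submatrix (Matrix.of (Fin.cons
              (fun k => (x k - 1) * ∏ j, (1 - x k * x (k.succAbove j))) fun (i : Fin n) k =>
                x k ^ (M + 2 * n + 1 - (i + 1)) - x k ^ (i + 1 : ℕ) :
              Fin (n + 1) → Fin (n + 1) → K)) Fin.succ k.succAbove).det := by
          rw [← Matrix.det_mul_row]
          congr 1
          ext i j
          simp only [Matrix.of_apply, Matrix.submatrix_apply, Fin.cons_succ]
          rw [show M + 2 * n + 1 - ((i : ℕ) + 1) = (M + 1 + 2 * n - 2 - i) + 1 by omega]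
          ring
        rw [← h2, ← h]
        simp only [Matrix.of_apply, Fin.cons_zero]
        ring

/-! ### Summing determinants over interlacing tuples. -/

/-- By multilinearity the sum enters the rows as geometric sums, which the factors Q^(j+1) - 1 turn
into differences of consecutive Vandermonde rows. Those row operations clear column 0 of the
Vandermonde matrix below its top entry, leaving this minor. -/
theorem sum_det_interlacing {K : Type*} [CommRing K] (Q : K) {n : ℕ} (l : Fin (n + 1) → ℕ)
    (hl : ∀ i : Fin n, l i.castSucc ≤ l i.succ) :
    (∑ k ∈ Fintype.piFinset fun i : Fin n => Finset.Ico (l i.castSucc) (l i.succ),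
      (Matrix.of fun i j : Fin n => Q ^ (k i * (j + 1 : ℕ))).det) *
        ∏ j : Fin n, (Q ^ (j + 1 : ℕ) - 1) =
      (Matrix.vandermonde fun i => Q ^ l i).det := by
  have h1 : (∑ k ∈ Fintype.piFinset fun i : Fin n => Finset.Ico (l i.castSucc) (l i.succ),
      (Matrix.of fun i j : Fin n => Q ^ (k i * (j + 1 : ℕ))).det) =
      (Matrix.of fun i j : Fin n =>
        ∑ k ∈ Finset.Ico (l i.castSucc) (l i.succ), Q ^ (k * (j + 1 : ℕ))).det := by
    have := (Matrix.detRowAlternating (n := Fin n) (R := K)).toMultilinearMap.map_sum_finset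
      (fun (i : Fin n) (k : ℕ) => fun j : Fin n => Q ^ (k * (j + 1 : ℕ)))
      (fun i : Fin n => Finset.Ico (l i.castSucc) (l i.succ))
    refine this.symm.trans (congrArg Matrix.det ?_)
    ext i j
    simp [Finset.sum_apply]
  rw [h1, mul_comm, ← Matrix.det_mul_row]
  have h2 : (Matrix.vandermonde fun i => Q ^ l i).det = (Matrix.of (Fin.cons
      (fun j : Fin (n + 1) => Q ^ (l 0 * j)) fun (i : Fin n) (j : Fin (n + 1)) =>
        Q ^ (l i.succ * j) - Q ^ (l i.castSucc * j) : Fin (n + 1) → Fin (n + 1) → K)).det := by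
    apply Matrix.det_eq_of_forall_row_eq_smul_add_pred (fun _ => 1)
    · intro j; simp [Matrix.vandermonde_apply, pow_mul]
    · intro i j; simp [Matrix.vandermonde_apply, pow_mul]
  rw [h2, Matrix.det_succ_column_zero, Fin.sum_univ_succ]
  rw [Finset.sum_eq_zero (fun i _ => by simp), add_zero]
  simp only [Fin.val_zero, pow_zero, Matrix.of_apply, Fin.cons_zero, mul_zero, mul_one, one_mul]
  congr 1
  ext i j
  simp only [Matrix.of_apply, Matrix.submatrix_apply, Fin.succAbove_zero, Fin.cons_succ,
    Fin.val_succ]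
  have := geom_sum_Ico_mul (Q ^ (j + 1 : ℕ)) (hl i)
  simp only [← pow_mul] at this
  rw [mul_comm (l i.succ), mul_comm (l i.castSucc), ← this, mul_comm]
  simp only [mul_comm]

/-- Adding i to the i-th entry turns the closed intervals of weak interlacing into the half-open
ones of `sum_det_interlacing`. -/
theorem sum_det_interlacing_partition {K : Type*} [CommRing K] (Q : K) {n : ℕ}
    (l : Fin (n + 1) → ℕ) (hl : Monotone l) :
    (∑ k ∈ Fintype.piFinset fun i : Fin n => Finset.Icc (l i.castSucc) (l i.succ),
      (Matrix.of fun i j : Fin n => Q ^ ((k i + i) * (j + 1 : ℕ))).det) *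
        ∏ j : Fin n, (Q ^ (j + 1 : ℕ) - 1) =
      (Matrix.vandermonde fun i => Q ^ (l i + i)).det := by
  rw [← sum_det_interlacing Q (fun i => l i + i) (fun i => by
    have := hl (Fin.castSucc_lt_succ (i := i)).le
    simp
    omega)]
  congr 1
  refine Finset.sum_bij' (fun k _ i => k i + i) (fun k _ i => k i - i) ?_ ?_ ?_ ?_ ?_
  · intro k hk
    simp only [Fintype.mem_piFinset, Finset.mem_Icc, Finset.mem_Ico, Fin.val_succ,
      Fin.val_castSucc] at *
    intro i
    have := hk i
    omega
  · intro k hk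
    simp only [Fintype.mem_piFinset, Finset.mem_Icc, Finset.mem_Ico, Fin.val_succ,
      Fin.val_castSucc] at *
    intro i
    have := hk i
    omega
  · intro k hk; simp
  · intro k hk
    simp only [Fintype.mem_piFinset, Finset.mem_Ico, Fin.val_castSucc] at hk
    ext i
    have := hk i
    dsimp only
    omega
  · intro k hk; rfl

/-- `det (Q ^ (i * j))`, the value of the alternant at the empty partition. -/
noncomputable def powVandermonde {K : Type*} [CommRing K] (Q : K) (n : ℕ) : K :=
  (Matrix.vandermonde fun i : Fin n => Q ^ (i : ℕ)).det

theorem powVandermonde_eq_prod {K : Type*} [CommRing K] (Q : K) (n : ℕ) :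
    powVandermonde Q n = ∏ i : Fin n, ∏ j ∈ Finset.Ioi i, (Q ^ (j : ℕ) - Q ^ (i : ℕ)) :=
  Matrix.det_vandermonde _

theorem det_pow_mul_succ {K : Type*} [CommRing K] (Q : K) {n : ℕ} (l : Fin n → ℕ) :
    (Matrix.of fun i j : Fin n => Q ^ (l i * (j + 1 : ℕ))).det =
      (∏ i, Q ^ l i) * (Matrix.vandermonde fun i => Q ^ l i).det := by
  rw [← Matrix.det_mul_column]
  congr 1
  ext i j
  simp only [Matrix.of_apply, Matrix.vandermonde_apply]
  ring

/-- The interlacing identity for the empty partition, where the sum has a single term. -/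
theorem powVandermonde_succ {K : Type*} [CommRing K] (Q : K) (n : ℕ) :
    powVandermonde Q (n + 1) = (∏ i : Fin n, Q ^ (i : ℕ)) * powVandermonde Q n *
      ∏ j : Fin n, (Q ^ (j + 1 : ℕ) - 1) := by
  have := sum_det_interlacing_partition Q (n := n) (fun _ => 0) monotone_const
  have hs : (Fintype.piFinset fun i : Fin n => Finset.Icc 0 0) = {fun _ => 0} := by
    ext k
    simp [funext_iff]
  rw [hs, Finset.sum_singleton, det_pow_mul_succ] at this
  simpa [powVandermonde] using this.symm

/-! ### Evaluation of the reflected determinant at odd powers of q. -/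

/-- The monic polynomials with `p_j (a ^ 2 + b ^ 2) = (a ^ (2 j + 1) - b ^ (2 j + 1)) / (a - b)`
whenever `a * b = c`. -/
noncomputable def oddDiffPoly {K : Type*} [CommRing K] (c : K) : ℕ → Polynomial K
  | 0 => 1
  | 1 => Polynomial.X + Polynomial.C c
  | j + 2 => Polynomial.X * oddDiffPoly c (j + 1) - Polynomial.C (c ^ 2) * oddDiffPoly c j

theorem oddDiffPoly_monic_natDegree {K : Type*} [CommRing K] [Nontrivial K] (c : K) (j : ℕ) :
    (oddDiffPoly c j).Monic ∧ (oddDiffPoly c j).natDegree = j := by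
  induction j using Nat.strong_induction_on with
  | _ j ih =>
    match j with
    | 0 => simp [oddDiffPoly]
    | 1 => exact ⟨Polynomial.monic_X_add_C c, Polynomial.natDegree_X_add_C c⟩
    | j + 2 =>
      obtain ⟨hm, hd⟩ := ih (j + 1) (by omega)
      obtain ⟨hm', hd'⟩ := ih j (by omega)
      have h1 : (Polynomial.X * oddDiffPoly c (j + 1)).Monic := Polynomial.monic_X.mul hm
      have h2 : (Polynomial.X * oddDiffPoly c (j + 1)).natDegree = j + 2 := by
        rw [Polynomial.monic_X.natDegree_mul hm, Polynomial.natDegree_X, hd]; omega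
      have h3 : (Polynomial.C (c ^ 2) * oddDiffPoly c j).natDegree <
          (Polynomial.X * oddDiffPoly c (j + 1)).natDegree := by
        have := Polynomial.natDegree_C_mul_le (c ^ 2) (oddDiffPoly c j)
        omega
      exact ⟨h1.sub_of_left (Polynomial.degree_lt_degree h3),
        (Polynomial.natDegree_sub_eq_left_of_natDegree_lt h3).trans h2⟩

theorem sub_mul_eval_oddDiffPoly {K : Type*} [CommRing K] {a b c : K} (hab : a * b = c) (j : ℕ) :
    (a - b) * (oddDiffPoly c j).eval (a ^ 2 + b ^ 2) = a ^ (2 * j + 1) - b ^ (2 * j + 1) := by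
  induction j using Nat.strong_induction_on with
  | _ j ih =>
    match j with
    | 0 => simp [oddDiffPoly]
    | 1 =>
      simp only [oddDiffPoly, Polynomial.eval_add, Polynomial.eval_X, Polynomial.eval_C, ← hab]
      ring
    | j + 2 =>
      have h1 := ih (j + 1) (by omega)
      have h0 := ih j (by omega)
      simp only [oddDiffPoly, Polynomial.eval_sub, Polynomial.eval_mul, Polynomial.eval_X,
        Polynomial.eval_C]
      rw [← hab] at *
      linear_combination (a ^ 2 + b ^ 2) * h1 - (a * b) ^ 2 * h0

/-- Once a_i - b_i is taken out of row i, column j holds a monic polynomial of degree j in a_i^2 +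
b_i^2, the same for all rows because a_i b_i is constant. -/
theorem det_odd_pow_sub {K : Type*} [CommRing K] [Nontrivial K] {n : ℕ} (a b : Fin n → K) (c : K)
    (hab : ∀ i, a i * b i = c) :
    (Matrix.of fun i j : Fin n => a i ^ (2 * j + 1 : ℕ) - b i ^ (2 * j + 1 : ℕ)).det =
      (∏ i, (a i - b i)) *
        ∏ i, ∏ j ∈ Finset.Ioi i, ((a j ^ 2 + b j ^ 2) - (a i ^ 2 + b i ^ 2)) := by
  rw [← Matrix.det_vandermonde, Matrix.det_eval_matrixOfPolynomials_eq_det_vandermonde _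
    (fun j => oddDiffPoly c j) (fun j => (oddDiffPoly_monic_natDegree c j).2)
    (fun j => (oddDiffPoly_monic_natDegree c j).1), ← Matrix.det_mul_column]
  congr 1
  ext i j
  simp only [Matrix.of_apply]
  rw [sub_mul_eval_oddDiffPoly (hab i)]

/-- The entries are odd-power differences of a_i = q^(B-i) and b_i = q^i, with a_i b_i = q^B. -/
theorem det_reflect_odd_powers {K : Type*} [CommRing K] [Nontrivial K] (q : K) {n : ℕ} (B : ℕ)
    (hB : 2 * n ≤ B + 2) :
    (Matrix.of fun i j : Fin n =>
        (q ^ (2 * j + 1 : ℕ)) ^ (B - i) - (q ^ (2 * j + 1 : ℕ)) ^ (i : ℕ)).det =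
      (∏ i : Fin n, q ^ (i : ℕ)) * (∏ i : Fin n, (q ^ (B - 2 * i) - 1)) *
        (powVandermonde (q ^ 2) n *
          ∏ i : Fin n, ∏ j ∈ Finset.Ioi i, (1 - q ^ (2 * (B - i - j)))) := by
  have h := det_odd_pow_sub (fun i : Fin n => q ^ (B - i : ℕ)) (fun i => q ^ (i : ℕ)) (q ^ B)
    (fun i => by rw [← pow_add]; congr 1; omega)
  simp only [← pow_mul] at h ⊢
  simp only [mul_comm (2 * _ + 1)]
  rw [h]
  congr 1
  · rw [← Finset.prod_mul_distrib]
    refine Finset.prod_congr rfl fun i _ => ?_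
    nth_rw 1 [show B - (i : ℕ) = i + (B - 2 * i) by omega]
    ring
  · rw [powVandermonde_eq_prod, ← Finset.prod_mul_distrib]
    refine Finset.prod_congr rfl fun i _ => ?_
    rw [← Finset.prod_mul_distrib]
    refine Finset.prod_congr rfl fun j hj => ?_
    have hij : i < j := Finset.mem_Ioi.1 hj
    have hij' : (i : ℕ) < j := hij
    have hj' := j.2
    -- With d = B - i - j, the difference of the a^2 + b^2 factors as (q^(2j) - q^(2i))(1 - q^(2d)).
    obtain ⟨d, hd⟩ : ∃ d, B = i + j + d := ⟨B - i - j, by omega⟩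
    rw [show B - (i : ℕ) = j + d by omega, show B - (j : ℕ) = i + d by omega,
      show (j : ℕ) + d - j = d by omega]
    ring

/-! ### Deleting and inserting the diagonal. -/

/-- The number of points of `P` above `(i, j)`. -/
def columnHeight (P : Finset (ℕ × ℕ × ℕ)) (i j : ℕ) : ℕ :=
  (P.filter fun p => p.1 = i ∧ p.2.1 = j).card

theorem IsPlanePartition.mem_iff_le_columnHeight {P : Finset (ℕ × ℕ × ℕ)} (hP : IsPlanePartition P)
    (i j k : ℕ) : (i, j, k) ∈ P ↔ 1 ≤ k ∧ k ≤ columnHeight P i j := by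
  have hinj : Function.Injective fun k : ℕ => (i, j, k) := fun a b h => by simpa using h
  constructor
  · intro h
    have h1 := hP.1 i j k h
    refine ⟨h1.2.2, ?_⟩
    have hsub : (Finset.Icc 1 k).map ⟨_, hinj⟩ ⊆ P.filter fun p => p.1 = i ∧ p.2.1 = j := by
      intro p hp
      simp only [Finset.mem_map, Finset.mem_Icc, Function.Embedding.coeFn_mk] at hp
      obtain ⟨a, ha, rfl⟩ := hp
      simp only [Finset.mem_filter, and_self, and_true]
      exact hP.2 i j k h i j a h1.1 le_rfl h1.2.1 le_rfl ha.1 ha.2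
    simpa [columnHeight] using Finset.card_le_card hsub
  · rintro ⟨hk, hle⟩
    by_contra hnot
    have hsub : (P.filter fun p => p.1 = i ∧ p.2.1 = j) ⊆
        (Finset.Icc 1 (k - 1)).map ⟨_, hinj⟩ := by
      rintro ⟨a, b, c⟩ hp
      simp only [Finset.mem_filter] at hp
      obtain ⟨hp, rfl, rfl⟩ := hp
      have h1 := hP.1 a b c hp
      simp only [Finset.mem_map, Finset.mem_Icc, Function.Embedding.coeFn_mk]
      refine ⟨c, ⟨h1.2.2, ?_⟩, rfl⟩
      by_contra hc
      exact hnot (hP.2 a b c hp a b k h1.1 le_rfl h1.2.1 le_rfl hk (by omega))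
    have := Finset.card_le_card hsub
    rw [Finset.card_map, Nat.card_Icc] at this
    unfold columnHeight at hle
    omega

theorem columnHeight_le_of_imp {P Q : Finset (ℕ × ℕ × ℕ)} (hP : IsPlanePartition P)
    (hQ : IsPlanePartition Q) {i j r s : ℕ} (h : ∀ k, (i, j, k) ∈ P → (r, s, k) ∈ Q) :
    columnHeight P i j ≤ columnHeight Q r s := by
  rcases Nat.eq_zero_or_pos (columnHeight P i j) with h0 | h0
  · omega
  · exact ((hQ.mem_iff_le_columnHeight _ _ _).1 (h _
      ((hP.mem_iff_le_columnHeight _ _ _).2 ⟨h0, le_rfl⟩))).2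

theorem columnHeight_eq_of_iff {P : Finset (ℕ × ℕ × ℕ)} (hP : IsPlanePartition P) {i j a : ℕ}
    (h : ∀ k, 1 ≤ k → ((i, j, k) ∈ P ↔ k ≤ a)) : columnHeight P i j = a := by
  apply le_antisymm
  · rcases Nat.eq_zero_or_pos (columnHeight P i j) with h0 | h0
    · omega
    · exact (h _ h0).1 ((hP.mem_iff_le_columnHeight _ _ _).2 ⟨h0, le_rfl⟩)
  · rcases Nat.eq_zero_or_pos a with h0 | h0
    · omega
    · exact ((hP.mem_iff_le_columnHeight _ _ _).1 ((h a h0).2 le_rfl)).2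

/-- The heights of `P` along the diagonal of the `n × n` square, from the far corner inwards. -/
def diagonalHeights (n : ℕ) (P : Finset (ℕ × ℕ × ℕ)) (i : Fin n) : ℕ :=
  columnHeight P (n - i) (n - i)

theorem diagonalHeights_mem {n m : ℕ} {P : Finset (ℕ × ℕ × ℕ)}
    (hP : P ∈ boundedSymmetricPlanePartitions n m) :
    diagonalHeights n P ∈ monotoneTuples n (m + 1) := by
  rw [mem_boundedSymmetricPlanePartitions] at hP
  obtain ⟨⟨hP, -⟩, hb⟩ := hP
  rw [mem_monotoneTuples]
  constructor
  · intro i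
    unfold diagonalHeights
    rcases Nat.eq_zero_or_pos (columnHeight P (n - i) (n - i)) with h0 | h0
    · omega
    · have := hb _ _ _ ((hP.mem_iff_le_columnHeight _ _ _).2 ⟨h0, le_rfl⟩)
      omega
  · intro i j hij
    have hij' : (i : ℕ) ≤ j := hij
    refine columnHeight_le_of_imp hP hP fun k hk => ?_
    have := hP.1 _ _ _ hk
    exact hP.2 _ _ _ hk _ _ _ (by omega) (by omega) (by omega) (by omega) (by omega) le_rfl

/-- Delete the diagonal of a symmetric plane partition and close up the two halves. -/
def deleteDiagonal (n m : ℕ) (P : Finset (ℕ × ℕ × ℕ)) : Finset (ℕ × ℕ × ℕ) :=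
  (Finset.Icc 1 n ×ˢ Finset.Icc 1 n ×ˢ Finset.Icc 1 m).filter
    fun p => (min p.1 p.2.1, max p.1 p.2.1 + 1, p.2.2) ∈ P

/-- Insert a diagonal with heights `h` into a symmetric plane partition. -/
def insertDiagonal (n m : ℕ) (h : ℕ → ℕ) (Q : Finset (ℕ × ℕ × ℕ)) : Finset (ℕ × ℕ × ℕ) :=
  (Finset.Icc 1 (n + 1) ×ˢ Finset.Icc 1 (n + 1) ×ˢ Finset.Icc 1 m).filter
    fun p => (p.1 = p.2.1 ∧ p.2.2 ≤ h p.1) ∨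
      (p.1 ≠ p.2.1 ∧ (min p.1 p.2.1, max p.1 p.2.1 - 1, p.2.2) ∈ Q)

theorem mem_deleteDiagonal {n m : ℕ} {P : Finset (ℕ × ℕ × ℕ)}
    (hP : P ∈ boundedSymmetricPlanePartitions (n + 1) m) (i j k : ℕ) :
    (i, j, k) ∈ deleteDiagonal n m P ↔ (min i j, max i j + 1, k) ∈ P := by
  rw [mem_boundedSymmetricPlanePartitions] at hP
  simp only [deleteDiagonal, Finset.mem_filter, Finset.mem_product, Finset.mem_Icc,
    and_iff_right_iff_imp]
  intro h
  have h1 := hP.1.1.1 _ _ _ h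
  have h2 := hP.2 _ _ _ h
  omega

theorem mem_insertDiagonal {n m : ℕ} {h : ℕ → ℕ} {Q : Finset (ℕ × ℕ × ℕ)}
    (hQ : Q ∈ boundedSymmetricPlanePartitions n m) (hm : ∀ d, h d ≤ m)
    (hs : ∀ d, h d ≠ 0 → 1 ≤ d ∧ d ≤ n + 1) (i j k : ℕ) :
    (i, j, k) ∈ insertDiagonal n m h Q ↔
      (1 ≤ k ∧ i = j ∧ k ≤ h i) ∨ (i ≠ j ∧ (min i j, max i j - 1, k) ∈ Q) := by
  rw [mem_boundedSymmetricPlanePartitions] at hQ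
  simp only [insertDiagonal, Finset.mem_filter, Finset.mem_product, Finset.mem_Icc]
  constructor
  · tauto
  · rintro (⟨hk, rfl, hle⟩ | ⟨hne, hmem⟩)
    · have := hm i
      have := hs i (by omega)
      omega
    · have h1 := hQ.1.1.1 _ _ _ hmem
      have h2 := hQ.2 _ _ _ hmem
      refine ⟨by omega, Or.inr ⟨hne, hmem⟩⟩

theorem deleteDiagonal_mem {n m : ℕ} {P : Finset (ℕ × ℕ × ℕ)}
    (hP : P ∈ boundedSymmetricPlanePartitions (n + 1) m) :
    deleteDiagonal n m P ∈ boundedSymmetricPlanePartitions n m := by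
  have hmem := mem_deleteDiagonal hP
  rw [mem_boundedSymmetricPlanePartitions] at hP
  rw [mem_boundedSymmetricPlanePartitions]
  refine ⟨⟨⟨?_, ?_⟩, ?_⟩, ?_⟩
  · intro i j k h
    have := hP.1.1.1 _ _ _ ((hmem _ _ _).1 h)
    omega
  · intro r s t h i j k hi hir hj hjs hk hkt
    rw [hmem] at h ⊢
    exact hP.1.1.2 _ _ _ h _ _ _ (by omega) (by omega) (by omega) (by omega) hk hkt
  · intro i j k
    rw [hmem, hmem, min_comm, max_comm]
  · intro i j k h
    have := hP.2 _ _ _ ((hmem _ _ _).1 h)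
    omega

/-- `hle` and `hge` say that the diagonal of `Q` interlaces `h`: its height at d lies between h (d +
1) and h d. This is the monotonicity between a diagonal cell and its neighbours. -/
theorem insertDiagonal_mem {n m : ℕ} {h : ℕ → ℕ} {Q : Finset (ℕ × ℕ × ℕ)}
    (hQ : Q ∈ boundedSymmetricPlanePartitions n m) (hm : ∀ d, h d ≤ m)
    (hs : ∀ d, h d ≠ 0 → 1 ≤ d ∧ d ≤ n + 1) (hle : ∀ d k, (d, d, k) ∈ Q → k ≤ h d)
    (hge : ∀ d k, 1 ≤ d → 1 ≤ k → k ≤ h (d + 1) → (d, d, k) ∈ Q) :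
    insertDiagonal n m h Q ∈ boundedSymmetricPlanePartitions (n + 1) m := by
  have hmem := mem_insertDiagonal hQ hm hs
  rw [mem_boundedSymmetricPlanePartitions] at hQ
  rw [mem_boundedSymmetricPlanePartitions]
  refine ⟨⟨⟨?_, ?_⟩, ?_⟩, ?_⟩
  · intro i j k hp
    rcases (hmem _ _ _).1 hp with ⟨hk, rfl, hle⟩ | ⟨hne, hq⟩
    · have := hs i (by omega)
      omega
    · have := hQ.1.1.1 _ _ _ hq
      omega
  · intro r s t hp i j k hi hir hj hjs hk hkt
    rw [hmem]
    rcases (hmem _ _ _).1 hp with ⟨ht, rfl, htr⟩ | ⟨hne, hq⟩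
    · by_cases hr : r = 1
      · have : i = 1 := by omega
        have : j = 1 := by omega
        subst hr
        subst i
        subst j
        exact Or.inl ⟨hk, rfl, by omega⟩
      -- A diagonal point with r > 1 lies over the point (r - 1, r - 1, t) of `Q`, which dominates
      -- every point of `Q` needed below it.
      · have hq := hge (r - 1) t (by omega) ht (by rwa [show r - 1 + 1 = r by omega])
        by_cases hij : i = j
        · subst hij
          by_cases hir' : i = r
          · subst hir'
            exact Or.inl ⟨hk, rfl, by omega⟩
          · exact Or.inl ⟨hk, rfl, hle _ _ (hQ.1.1.2 _ _ _ hq i i k hi (by omega) hi (by omega)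
              hk hkt)⟩
        · exact Or.inr ⟨hij, hQ.1.1.2 _ _ _ hq _ _ _ (by omega) (by omega) (by omega) (by omega)
            hk hkt⟩
    · by_cases hij : i = j
      · subst hij
        exact Or.inl ⟨hk, rfl, hle _ _ (hQ.1.1.2 _ _ _ hq i i k hi (by omega) hi (by omega)
          hk hkt)⟩
      · exact Or.inr ⟨hij, hQ.1.1.2 _ _ _ hq _ _ _ (by omega) (by omega) (by omega) (by omega)
          hk hkt⟩
  · intro i j k
    rw [hmem, hmem, min_comm, max_comm]
    constructor
    · rintro (⟨hk, rfl, hle⟩ | ⟨hne, hq⟩)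
      · exact Or.inl ⟨hk, rfl, hle⟩
      · exact Or.inr ⟨hne.symm, hq⟩
    · rintro (⟨hk, rfl, hle⟩ | ⟨hne, hq⟩)
      · exact Or.inl ⟨hk, rfl, hle⟩
      · exact Or.inr ⟨hne.symm, hq⟩
  · intro i j k hp
    rcases (hmem _ _ _).1 hp with ⟨hk, rfl, hle⟩ | ⟨hne, hq⟩
    · have := hs i (by omega)
      have := hm i
      omega
    · have := hQ.2 _ _ _ hq
      omega

theorem card_filter_diagonal {n m : ℕ} {P : Finset (ℕ × ℕ × ℕ)}
    (hP : P ∈ boundedSymmetricPlanePartitions n m) :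
    (P.filter fun p => p.1 = p.2.1).card = ∑ i, diagonalHeights n P i := by
  rw [mem_boundedSymmetricPlanePartitions] at hP
  have h1 : (P.filter fun p => p.1 = p.2.1).card =
      ∑ d ∈ Finset.range n, columnHeight P (n - d) (n - d) := by
    rw [Finset.card_eq_sum_card_fiberwise (f := fun p : ℕ × ℕ × ℕ => n - p.1)
      (t := Finset.range n)]
    · refine Finset.sum_congr rfl fun d hd => ?_
      unfold columnHeight
      rw [Finset.filter_filter]
      congr 1
      ext ⟨i, j, k⟩
      simp only [Finset.mem_filter, Finset.mem_range] at *
      refine and_congr_right fun hp => ?_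
      have h1 := hP.1.1.1 _ _ _ hp
      have h2 := hP.2 _ _ _ hp
      omega
    · rintro ⟨i, j, k⟩ hp
      simp only [Finset.coe_filter, Set.mem_ofPred_eq] at hp
      have h1 := hP.1.1.1 _ _ _ hp.1
      have h2 := hP.2 _ _ _ hp.1
      simp only [Finset.coe_range, Set.mem_Iio]
      omega
  rw [h1, ← Fin.sum_univ_eq_sum_range (fun d => columnHeight P (n - d) (n - d))]
  rfl

theorem card_eq_diagonal_add_two_mul {P : Finset (ℕ × ℕ × ℕ)} (hP : IsSymmetricPlanePartition P) :
    P.card = (P.filter fun p => p.1 = p.2.1).card + 2 * (P.filter fun p => p.1 < p.2.1).card := by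
  have h1 : (P.filter fun p => p.1 < p.2.1).card = (P.filter fun p => p.2.1 < p.1).card := by
    refine Finset.card_bij' (fun p _ => (p.2.1, p.1, p.2.2)) (fun p _ => (p.2.1, p.1, p.2.2))
      ?_ ?_ (fun _ _ => rfl) (fun _ _ => rfl)
    · rintro ⟨i, j, k⟩ h
      simp only [Finset.mem_filter] at h ⊢
      exact ⟨(hP.2 _ _ _).1 h.1, h.2⟩
    · rintro ⟨i, j, k⟩ h
      simp only [Finset.mem_filter] at h ⊢
      exact ⟨(hP.2 _ _ _).1 h.1, h.2⟩
  have h2 : (P.filter fun p => p.1 ≠ p.2.1).card =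
      (P.filter fun p => p.1 < p.2.1).card + (P.filter fun p => p.2.1 < p.1).card := by
    rw [← Finset.card_union_of_disjoint, ← Finset.filter_or]
    · congr 1
      ext p
      simp only [Finset.mem_filter]
      exact and_congr_right fun _ => by omega
    · rw [Finset.disjoint_filter]
      intro p _
      omega
  have h3 := Finset.card_filter_add_card_filter_not (s := P) (fun p => p.1 = p.2.1)
  simp only [← ne_eq] at h3
  omega

/-- Points of `P` strictly above the diagonal match points of the new partition on or above its
diagonal. If d', u' count its points on and strictly above the diagonal, and d those on the diagonal
of `P`, then |P| = d + 2(d' + u'), while the new partition has d' + 2u' points. -/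
theorem card_eq_add_card_deleteDiagonal {n m : ℕ} {P : Finset (ℕ × ℕ × ℕ)}
    (hP : P ∈ boundedSymmetricPlanePartitions (n + 1) m) :
    P.card = ∑ i, diagonalHeights (n + 1) P i +
      (∑ i, diagonalHeights n (deleteDiagonal n m P) i + (deleteDiagonal n m P).card) := by
  have hQ := deleteDiagonal_mem hP
  rw [← card_filter_diagonal hP, ← card_filter_diagonal hQ]
  have hmem := mem_deleteDiagonal hP
  rw [mem_boundedSymmetricPlanePartitions] at hP hQ
  have h1 := card_eq_diagonal_add_two_mul hP.1
  have h2 := card_eq_diagonal_add_two_mul hQ.1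
  have h3 : (P.filter fun p => p.1 < p.2.1).card =
      ((deleteDiagonal n m P).filter fun p => p.1 ≤ p.2.1).card := by
    refine Finset.card_bij' (fun p _ => (p.1, p.2.1 - 1, p.2.2)) (fun p _ => (p.1, p.2.1 + 1, p.2.2))
      ?_ ?_ ?_ ?_
    · rintro ⟨i, j, k⟩ h
      simp only [Finset.mem_filter] at h ⊢
      rw [hmem, min_eq_left (by omega), max_eq_right (by omega), Nat.sub_add_cancel (by omega)]
      exact ⟨h.1, by omega⟩
    · rintro ⟨i, j, k⟩ h
      simp only [Finset.mem_filter] at h ⊢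
      rw [hmem, min_eq_left (by omega), max_eq_right (by omega)] at h
      exact ⟨h.1, by omega⟩
    · rintro ⟨i, j, k⟩ h
      simp only [Finset.mem_filter] at h
      simp only [Prod.mk.injEq, true_and, and_true]
      omega
    · rintro ⟨i, j, k⟩ h
      simp
  have h4 : ((deleteDiagonal n m P).filter fun p => p.1 ≤ p.2.1).card =
      ((deleteDiagonal n m P).filter fun p => p.1 = p.2.1).card +
        ((deleteDiagonal n m P).filter fun p => p.1 < p.2.1).card := by
    rw [← Finset.card_union_of_disjoint, ← Finset.filter_or]
    · congr 1
      ext p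
      simp only [Finset.mem_filter]
      exact and_congr_right fun _ => by omega
    · rw [Finset.disjoint_filter]
      intro p _
      omega
  omega

/-! ### The generating function with prescribed diagonal. -/

/-- The generating function of the bounded symmetric plane partitions with given diagonal. -/
noncomputable def diagonalGF {K : Type*} [CommRing K] (q : K) (n m : ℕ) (l : Fin n → ℕ) : K :=
  ∑ P ∈ (boundedSymmetricPlanePartitions n m).filter fun P => diagonalHeights n P = l, q ^ P.card

theorem columnHeight_insertDiagonal {n m : ℕ} {h : ℕ → ℕ} {Q : Finset (ℕ × ℕ × ℕ)}
    (hQ : Q ∈ boundedSymmetricPlanePartitions n m) (hm : ∀ d, h d ≤ m)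
    (hs : ∀ d, h d ≠ 0 → 1 ≤ d ∧ d ≤ n + 1) (hP : IsPlanePartition (insertDiagonal n m h Q))
    (d : ℕ) : columnHeight (insertDiagonal n m h Q) d d = h d := by
  apply columnHeight_eq_of_iff hP
  intro k hk
  rw [mem_insertDiagonal hQ hm hs]
  simp [hk]

theorem diagonalHeights_deleteDiagonal_mem {n m : ℕ} {P : Finset (ℕ × ℕ × ℕ)}
    (hP : P ∈ boundedSymmetricPlanePartitions (n + 1) m) (i : Fin n) :
    diagonalHeights (n + 1) P i.castSucc ≤ diagonalHeights n (deleteDiagonal n m P) i ∧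
      diagonalHeights n (deleteDiagonal n m P) i ≤ diagonalHeights (n + 1) P i.succ := by
  have hQ := deleteDiagonal_mem hP
  have hmem := mem_deleteDiagonal hP
  rw [mem_boundedSymmetricPlanePartitions] at hP hQ
  have hi := i.2
  constructor
  · refine columnHeight_le_of_imp hP.1.1 hQ.1.1 fun k hk => ?_
    rw [Fin.val_castSucc] at hk
    rw [hmem]
    exact hP.1.1.2 _ _ _ hk _ _ _ (by omega) (by omega) (by omega) (by omega)
      (hP.1.1.1 _ _ _ hk).2.2 le_rfl
  · refine columnHeight_le_of_imp hQ.1.1 hP.1.1 fun k hk => ?_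
    rw [hmem] at hk
    rw [Fin.val_succ]
    exact hP.1.1.2 _ _ _ hk _ _ _ (by omega) (by omega) (by omega) (by omega)
      (hP.1.1.1 _ _ _ hk).2.2 le_rfl

/-- Deletion and insertion are inverse bijections between partitions with diagonal `l` and smaller
ones whose diagonal interlaces `l`. -/
theorem diagonalGF_succ {K : Type*} [CommRing K] (q : K) (n m : ℕ) (l : Fin (n + 1) → ℕ)
    (hl : l ∈ monotoneTuples (n + 1) (m + 1)) :
    diagonalGF q (n + 1) m l = q ^ (∑ i, l i) *
      ∑ k ∈ Fintype.piFinset fun i : Fin n => Finset.Icc (l i.castSucc) (l i.succ),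
        q ^ (∑ i, k i) * diagonalGF q n m k := by
  classical
  rw [mem_monotoneTuples] at hl
  set S := Fintype.piFinset fun i : Fin n => Finset.Icc (l i.castSucc) (l i.succ) with hS
  have hR : ∑ k ∈ S, q ^ (∑ i, k i) * diagonalGF q n m k =
      ∑ Q ∈ (boundedSymmetricPlanePartitions n m).filter fun Q => diagonalHeights n Q ∈ S,
        q ^ (∑ i, diagonalHeights n Q i) * q ^ Q.card := by
    rw [← Finset.sum_fiberwise_of_maps_to (t := S) (g := diagonalHeights n)
      (fun Q hQ => (Finset.mem_filter.1 hQ).2)]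
    refine Finset.sum_congr rfl fun k hk => ?_
    rw [diagonalGF, Finset.mul_sum, Finset.filter_filter]
    refine Finset.sum_congr ?_ fun Q hQ => ?_
    · ext Q
      simp only [Finset.mem_filter]
      refine and_congr_right fun _ => ⟨fun h => ⟨h ▸ hk, h⟩, fun h => h.2⟩
    · rw [(Finset.mem_filter.1 hQ).2.2]
  rw [hR, Finset.mul_sum, diagonalGF]
  -- The tuple `l` runs inwards from the far corner, so position d on the diagonal carries index n +
  -- 1 - d; outside the square the height is 0.
  let h : ℕ → ℕ := fun d => if hd : 1 ≤ d ∧ d ≤ n + 1 then l ⟨n + 1 - d, by omega⟩ else 0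
  have hm : ∀ d, h d ≤ m := by
    intro d
    simp only [h]
    split_ifs with hd
    · exact Nat.lt_succ_iff.1 (hl.1 _)
    · exact Nat.zero_le _
  have hs : ∀ d, h d ≠ 0 → 1 ≤ d ∧ d ≤ n + 1 := by
    intro d hd
    by_contra hc
    exact hd (dif_neg hc)
  have hval : ∀ i : Fin (n + 1), h (n + 1 - i) = l i := by
    intro i
    have := i.2
    simp only [h]
    rw [dif_pos (by omega)]
    congr 1
    ext
    simp only
    omega
  have hdiag : ∀ Q ∈ boundedSymmetricPlanePartitions n m, diagonalHeights n Q ∈ S →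
      (∀ d k, (d, d, k) ∈ Q → k ≤ h d) ∧
        ∀ d k, 1 ≤ d → 1 ≤ k → k ≤ h (d + 1) → (d, d, k) ∈ Q := by
    intro Q hQ hQS
    rw [mem_boundedSymmetricPlanePartitions] at hQ
    simp only [hS, Fintype.mem_piFinset, Finset.mem_Icc] at hQS
    have hQd : ∀ d (hd : 1 ≤ d ∧ d ≤ n), h (d + 1) ≤ columnHeight Q d d ∧
        columnHeight Q d d ≤ h d := by
      intro d hd
      have := hQS ⟨n - d, by omega⟩
      rw [← hval, ← hval] at this
      simp only [diagonalHeights, Fin.val_castSucc, Fin.val_succ] at this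
      rwa [show n - (n - d) = d by omega, show n + 1 - (n - d) = d + 1 by omega,
        show n + 1 - (n - d + 1) = d by omega] at this
    constructor
    · intro d k hk
      have h1 := hQ.1.1.1 _ _ _ hk
      have h2 := hQ.2 _ _ _ hk
      exact ((hQ.1.1.mem_iff_le_columnHeight _ _ _).1 hk).2.trans (hQd d ⟨h1.1, h2.1⟩).2
    · intro d k hd hk hle
      have := hs (d + 1) (by omega)
      exact (hQ.1.1.mem_iff_le_columnHeight _ _ _).2
        ⟨hk, hle.trans (hQd d ⟨hd, by omega⟩).1⟩
  refine Finset.sum_bij' (fun P _ => deleteDiagonal n m P) (fun Q _ => insertDiagonal n m h Q)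
    ?_ ?_ ?_ ?_ ?_
  · intro P hP
    rw [Finset.mem_filter] at hP ⊢
    refine ⟨deleteDiagonal_mem hP.1, ?_⟩
    rw [hS, Fintype.mem_piFinset]
    intro i
    rw [Finset.mem_Icc, ← hP.2]
    exact diagonalHeights_deleteDiagonal_mem hP.1 i
  · intro Q hQ
    rw [Finset.mem_filter] at hQ ⊢
    obtain ⟨h1, h2⟩ := hdiag Q hQ.1 hQ.2
    have hP := insertDiagonal_mem hQ.1 hm hs h1 h2
    refine ⟨hP, ?_⟩
    ext i
    rw [diagonalHeights, columnHeight_insertDiagonal hQ.1 hm hs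
      ((mem_boundedSymmetricPlanePartitions _ _ _).1 hP).1.1, hval]
  · intro P hP
    rw [Finset.mem_filter] at hP
    have hQ := deleteDiagonal_mem hP.1
    have hmem := mem_deleteDiagonal hP.1
    ext ⟨i, j, k⟩
    rw [mem_insertDiagonal hQ hm hs, hmem]
    have hP' := (mem_boundedSymmetricPlanePartitions _ _ _).1 hP.1
    by_cases hij : i = j
    · subst hij
      rw [hP'.1.1.mem_iff_le_columnHeight i i k]
      by_cases hi : 1 ≤ i ∧ i ≤ n + 1
      · have h1 : columnHeight P i i = h i := by
          have := congrFun hP.2 ⟨n + 1 - i, by omega⟩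
          rw [← hval] at this
          simp only [diagonalHeights] at this
          rwa [show n + 1 - (n + 1 - i) = i by omega] at this
        simp [h1]
      · have h1 : columnHeight P i i = 0 := by
          apply columnHeight_eq_of_iff hP'.1.1
          intro k hk
          constructor
          · intro hmem
            have h1 := hP'.1.1.1 _ _ _ hmem
            have h2 := hP'.2 _ _ _ hmem
            omega
          · omega
        have h2 : h i = 0 := dif_neg hi
        simp [h1, h2]
    · simp only [hij, false_and, and_false, ne_eq, not_false_eq_true, true_and, false_or]
      rcases lt_or_gt_of_ne hij with hlt | hlt
      · rw [show min (min i j) (max i j - 1) = i by omega,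
          show max (min i j) (max i j - 1) + 1 = j by omega]
      · rw [show min (min i j) (max i j - 1) = j by omega,
          show max (min i j) (max i j - 1) + 1 = i by omega, hP'.1.2]
  · intro Q hQ
    rw [Finset.mem_filter] at hQ
    obtain ⟨h1, h2⟩ := hdiag Q hQ.1 hQ.2
    have hP := insertDiagonal_mem hQ.1 hm hs h1 h2
    ext ⟨i, j, k⟩
    rw [mem_deleteDiagonal hP, mem_insertDiagonal hQ.1 hm hs]
    have hQ' := (mem_boundedSymmetricPlanePartitions _ _ _).1 hQ.1
    have hne : min i j ≠ max i j + 1 := by omega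
    simp only [hne, false_and, and_false, ne_eq, not_false_eq_true, true_and, false_or]
    rcases le_total i j with hle | hle
    · rw [show min (min i j) (max i j + 1) = i by omega,
        show max (min i j) (max i j + 1) - 1 = j by omega]
    · rw [show min (min i j) (max i j + 1) = j by omega,
        show max (min i j) (max i j + 1) - 1 = i by omega, hQ'.1.2]
  · intro P hP
    rw [Finset.mem_filter] at hP
    rw [← pow_add, ← pow_add, card_eq_add_card_deleteDiagonal hP.1, hP.2]

/-- The right side over `powVandermonde` is s_l(q, q^3, …, q^(2n-1)); the recursion on diagonals
becomes the interlacing identity at Q = q^2. -/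
theorem diagonalGF_mul_powVandermonde {K : Type*} [CommRing K] (q : K) (m : ℕ) :
    ∀ (n : ℕ) (l : Fin n → ℕ) (_ : l ∈ monotoneTuples n (m + 1)),
      diagonalGF q n m l * powVandermonde (q ^ 2) n =
        q ^ (∑ i, l i) * (Matrix.vandermonde fun i => (q ^ 2) ^ (l i + i)).det := by
  intro n
  induction n with
  | zero =>
    intro l _
    have : (boundedSymmetricPlanePartitions 0 m).filter
        (fun P => diagonalHeights 0 P = l) = {∅} := by
      ext P
      simp only [Finset.mem_filter, mem_boundedSymmetricPlanePartitions, Finset.mem_singleton]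
      constructor
      · rintro ⟨⟨hP, hb⟩, -⟩
        apply Finset.eq_empty_of_forall_notMem
        rintro ⟨i, j, k⟩ h
        have h1 := hP.1.1 _ _ _ h
        have h2 := hb _ _ _ h
        omega
      · rintro rfl
        exact ⟨⟨⟨⟨by simp, by simp⟩, by simp⟩, by simp⟩, Subsingleton.elim _ _⟩
    simp [diagonalGF, this, powVandermonde]
  | succ n ih =>
    intro l hl
    rw [diagonalGF_succ q n m l hl, mul_assoc]
    rw [mem_monotoneTuples] at hl
    rw [← sum_det_interlacing_partition _ l hl.2, powVandermonde_succ, Finset.sum_mul,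
      Finset.sum_mul]
    congr 1
    refine Finset.sum_congr rfl fun k hk => ?_
    rw [Fintype.mem_piFinset] at hk
    simp only [Finset.mem_Icc] at hk
    have hk' : k ∈ monotoneTuples n (m + 1) := by
      rw [mem_monotoneTuples]
      refine ⟨fun i => (hk i).2.trans_lt (hl.1 _), fun i j hij => ?_⟩
      rcases hij.eq_or_lt with rfl | hlt
      · rfl
      · exact (hk i).2.trans ((hl.2 (by
          rw [Fin.le_def, Fin.val_succ, Fin.val_castSucc]
          exact hlt)).trans (hk j).1)
    have := ih k hk'
    rw [det_pow_mul_succ (q ^ 2) (fun i => k i + i)]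
    -- One factor q^(∑ k) is the weight in the recursion, the other comes from the inductive
    -- formula.
    have hp : ∏ i : Fin n, (q ^ 2) ^ (k i + i) =
        q ^ (∑ i, k i) * q ^ (∑ i, k i) * ∏ i : Fin n, (q ^ 2) ^ (i : ℕ) := by
      simp_rw [pow_add (q ^ 2)]
      rw [Finset.prod_mul_distrib, Finset.prod_pow_eq_pow_sum]
      ring
    rw [hp]
    linear_combination (q ^ (∑ i, k i) * (∏ i : Fin n, (q ^ 2) ^ (i : ℕ)) *
      ∏ j : Fin n, ((q ^ 2) ^ (j + 1 : ℕ) - 1)) * this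

/-- At x_j = q^(2j+1) row i of the alternant is q^(l i + i) times a Vandermonde row in (q^2)^(l i +
i), so summing over diagonals gives `alternantSum`. -/
theorem sum_pow_card_mul_eq_alternantSum {K : Type*} [CommRing K] (q : K) (n m : ℕ) :
    (∑ P ∈ boundedSymmetricPlanePartitions n m, q ^ P.card) *
        ((∏ i : Fin n, q ^ (i : ℕ)) * powVandermonde (q ^ 2) n) =
      alternantSum n (m + 1) fun j : Fin n => q ^ (2 * j + 1 : ℕ) := by
  rw [← Finset.sum_fiberwise_of_maps_to (t := monotoneTuples n (m + 1)) (g := diagonalHeights n)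
    (fun P hP => diagonalHeights_mem hP), alternantSum, Finset.sum_mul]
  refine Finset.sum_congr rfl fun l hl => ?_
  have := diagonalGF_mul_powVandermonde q m n l hl
  rw [diagonalGF] at this
  have h2 : (Matrix.of fun i j : Fin n => (q ^ (2 * j + 1 : ℕ)) ^ (l i + i)).det =
      (∏ i, q ^ (l i + i)) * (Matrix.vandermonde fun i => (q ^ 2) ^ (l i + i)).det := by
    rw [← Matrix.det_mul_column]
    congr 1
    ext i j
    simp only [Matrix.of_apply, Matrix.vandermonde_apply]
    ring
  rw [h2]
  simp_rw [pow_add q]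
  rw [Finset.prod_mul_distrib, Finset.prod_pow_eq_pow_sum Finset.univ l q]
  linear_combination (∏ i : Fin n, q ^ (i : ℕ)) * this

/-! ### Reindexing the products and concluding in ℚ(q). -/

theorem prod_Icc_eq_prod_fin {M : Type*} [CommMonoid M] (n : ℕ) (f : ℕ → M) :
    ∏ i ∈ Finset.Icc 1 n, f i = ∏ i : Fin n, f (i + 1) := by
  rw [Fin.prod_univ_eq_prod_range (fun i => f (i + 1))]
  induction n with
  | zero => simp
  | succ n ih => rw [Finset.prod_Icc_succ_top (by omega), ih, Finset.prod_range_succ]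

theorem prod_Icc_eq_prod_fin_rev {M : Type*} [CommMonoid M] (n : ℕ) (f : ℕ → M) :
    ∏ i ∈ Finset.Icc 1 n, f i = ∏ i : Fin n, f (n - i) := by
  rw [prod_Icc_eq_prod_fin, ← Equiv.prod_comp Fin.revPerm]
  refine Finset.prod_congr rfl fun i _ => congrArg f ?_
  rw [Fin.revPerm_apply, Fin.val_rev]
  omega

theorem prod_Icc_prod_Ioc_eq_prod_fin {M : Type*} [CommMonoid M] (n : ℕ) (f : ℕ → ℕ → M) :
    ∏ i ∈ Finset.Icc 1 n, ∏ j ∈ Finset.Ioc i n, f i j =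
      ∏ i : Fin n, ∏ j ∈ Finset.Ioi i, f (i + 1) (j + 1) := by
  rw [prod_Icc_eq_prod_fin]
  refine Finset.prod_congr rfl fun i _ => ?_
  symm
  refine Finset.prod_bij (fun j _ => (j : ℕ) + 1) ?_ ?_ ?_ ?_
  · intro j hj
    have : i < j := Finset.mem_Ioi.1 hj
    rw [Finset.mem_Ioc]
    omega
  · intro j _ k _ h
    exact Fin.ext (by omega)
  · intro k hk
    rw [Finset.mem_Ioc] at hk
    refine ⟨⟨k - 1, by omega⟩, ?_, ?_⟩
    · rw [Finset.mem_Ioi, Fin.lt_def]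
      simp only
      omega
    · simp only
      omega
  · intro j _; rfl

theorem prod_Icc_prod_Ioc_eq_prod_fin_rev {M : Type*} [CommMonoid M] (n : ℕ) (f : ℕ → ℕ → M) :
    ∏ i ∈ Finset.Icc 1 n, ∏ j ∈ Finset.Ioc i n, f i j =
      ∏ i : Fin n, ∏ j ∈ Finset.Ioi i, f (n - j) (n - i) := by
  rw [prod_Icc_prod_Ioc_eq_prod_fin, Finset.prod_sigma', Finset.prod_sigma']
  refine Finset.prod_bij' (fun p _ => ⟨p.2.rev, p.1.rev⟩) (fun p _ => ⟨p.2.rev, p.1.rev⟩)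
    ?_ ?_ ?_ ?_ ?_
  · rintro ⟨i, j⟩ h
    simpa using h
  · rintro ⟨i, j⟩ h
    simpa using h
  · rintro ⟨i, j⟩ h
    simp
  · rintro ⟨i, j⟩ h
    simp
  · rintro ⟨i, j⟩ h
    simp only [Fin.val_rev]
    congr 1 <;> omega

theorem RatFunc_X_pow_ne_one {k : ℕ} (hk : k ≠ 0) : (RatFunc.X : RatFunc ℚ) ^ k ≠ 1 := by
  rw [← RatFunc.algebraMap_X, ← map_pow, ← map_one (algebraMap (Polynomial ℚ) (RatFunc ℚ))]
  intro h
  have := congrArg (Polynomial.eval 0) (RatFunc.algebraMap_injective ℚ h)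
  simp [hk] at this

theorem one_add_RatFunc_X_pow_ne_zero (k : ℕ) : 1 + (RatFunc.X : RatFunc ℚ) ^ k ≠ 0 := by
  rw [← RatFunc.algebraMap_X, ← map_pow, ← map_one (algebraMap (Polynomial ℚ) (RatFunc ℚ)),
    ← map_add, ← map_zero (algebraMap (Polynomial ℚ) (RatFunc ℚ))]
  intro h
  have := congrArg (Polynomial.eval 1) (RatFunc.algebraMap_injective ℚ h)
  norm_num at this

theorem powVandermonde_RatFunc_X_ne_zero (n : ℕ) :
    powVandermonde ((RatFunc.X : RatFunc ℚ) ^ 2) n ≠ 0 := by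
  induction n with
  | zero => simp [powVandermonde]
  | succ n ih =>
    rw [powVandermonde_succ]
    refine mul_ne_zero (mul_ne_zero ?_ ih) ?_
    · exact Finset.prod_ne_zero_iff.2 fun i _ => pow_ne_zero _ (pow_ne_zero _ RatFunc.X_ne_zero)
    · refine Finset.prod_ne_zero_iff.2 fun i _ => sub_ne_zero.2 ?_
      rw [← pow_mul]
      exact RatFunc_X_pow_ne_one (by omega)

/-- Here B = m + 2n - 1, so B - 2i = m + 2(n - i) - 1: the numerator factors appear in reversed
order, hence the indices n - i. The signs (-1)^n on the two sides cancel. -/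
theorem symmetricPlanePartitionGF_mul (n m : ℕ) :
    symmetricPlanePartitionGF n m *
        ((∏ i : Fin n, (1 - (RatFunc.X : RatFunc ℚ) ^ (2 * i + 1 : ℕ))) *
          ∏ i : Fin n, ∏ j ∈ Finset.Ioi i, (1 - RatFunc.X ^ (2 * (i + j + 1) : ℕ))) =
      (∏ i : Fin n, (1 - (RatFunc.X : RatFunc ℚ) ^ (m + 2 * (n - i) - 1))) *
        ∏ i : Fin n, ∏ j ∈ Finset.Ioi i,
          (1 - RatFunc.X ^ (2 * (m + (n - j) + (n - i) - 1) : ℕ)) := by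
  set q : RatFunc ℚ := RatFunc.X with hq
  have h1 := sum_pow_card_mul_eq_alternantSum q n m
  have h2 := alternantSum_mul_prod n (m + 1) (fun j : Fin n => q ^ (2 * j + 1 : ℕ))
    (fun k => pow_ne_zero _ RatFunc.X_ne_zero) (fun k => one_add_RatFunc_X_pow_ne_zero _)
  rw [det_reflect_odd_powers q (m + 1 + 2 * n - 2) (by omega), ← h1] at h2
  have hne : (∏ i : Fin n, q ^ (i : ℕ)) * powVandermonde (q ^ 2) n ≠ 0 :=
    mul_ne_zero (Finset.prod_ne_zero_iff.2 fun i _ => pow_ne_zero _ RatFunc.X_ne_zero)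
      (powVandermonde_RatFunc_X_ne_zero n)
  have e1 : ∏ i : Fin n, (q ^ (2 * i + 1 : ℕ) - 1) =
      (-1) ^ n * ∏ i : Fin n, (1 - q ^ (2 * i + 1 : ℕ)) := by
    simpa using (Finset.prod_neg (s := Finset.univ) fun i : Fin n => 1 - q ^ (2 * i + 1 : ℕ))
  have e2 : ∏ i : Fin n, (q ^ (m + 1 + 2 * n - 2 - 2 * i : ℕ) - 1) =
      (-1) ^ n * ∏ i : Fin n, (1 - q ^ (m + 2 * (n - i) - 1)) := by
    rw [show (∏ i : Fin n, (q ^ (m + 1 + 2 * n - 2 - 2 * i : ℕ) - 1)) =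
      ∏ i : Fin n, -(1 - q ^ (m + 2 * (n - i) - 1)) from Finset.prod_congr rfl fun i _ => by
        rw [neg_sub]; congr 2; omega]
    simpa using (Finset.prod_neg (s := Finset.univ) fun i : Fin n => 1 - q ^ (m + 2 * (n - i) - 1))
  have e3 : ∏ i : Fin n, ∏ j ∈ Finset.Ioi i,
        (1 - q ^ (2 * i + 1 : ℕ) * q ^ (2 * j + 1 : ℕ)) =
      ∏ i : Fin n, ∏ j ∈ Finset.Ioi i, (1 - q ^ (2 * (i + j + 1) : ℕ)) := by
    refine Finset.prod_congr rfl fun i _ => Finset.prod_congr rfl fun j _ => ?_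
    ring
  have e4 : ∏ i : Fin n, ∏ j ∈ Finset.Ioi i, (1 - q ^ (2 * (m + 1 + 2 * n - 2 - i - j) : ℕ)) =
      ∏ i : Fin n, ∏ j ∈ Finset.Ioi i,
          (1 - q ^ (2 * (m + (n - j) + (n - i) - 1) : ℕ)) := by
    refine Finset.prod_congr rfl fun i _ => Finset.prod_congr rfl fun j _ => ?_
    congr 3
    omega
  rw [e1, e2, e3, e4] at h2
  apply mul_left_cancel₀ hne
  apply mul_left_cancel₀ (pow_ne_zero n (neg_ne_zero.2 one_ne_zero) : (-1 : RatFunc ℚ) ^ n ≠ 0)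
  rw [symmetricPlanePartitionGF]
  linear_combination h2

theorem mainTheorem2 (n m : ℕ) :
    symmetricPlanePartitionGF n m =
      (∏ i ∈ Finset.Icc 1 n,
        (1 - (RatFunc.X : RatFunc ℚ) ^ (m + 2 * i - 1)) / (1 - RatFunc.X ^ (2 * i - 1))) *
      ∏ i ∈ Finset.Icc 1 n, ∏ j ∈ Finset.Ioc i n,
        (1 - (RatFunc.X : RatFunc ℚ) ^ (2 * (m + i + j - 1))) /
          (1 - RatFunc.X ^ (2 * (i + j - 1))) := by
  simp only [Finset.prod_div_distrib]
  rw [div_mul_div_comm, prod_Icc_eq_prod_fin_rev n fun i => 1 - RatFunc.X ^ (m + 2 * i - 1),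
    prod_Icc_eq_prod_fin n fun i => 1 - RatFunc.X ^ (2 * i - 1),
    prod_Icc_prod_Ioc_eq_prod_fin_rev n fun i j => 1 - RatFunc.X ^ (2 * (m + i + j - 1)),
    prod_Icc_prod_Ioc_eq_prod_fin n fun i j => 1 - RatFunc.X ^ (2 * (i + j - 1)),
    ← symmetricPlanePartitionGF_mul]
  have e1 : ∏ i : Fin n, (1 - (RatFunc.X : RatFunc ℚ) ^ (2 * (i + 1) - 1 : ℕ)) =
      ∏ i : Fin n, (1 - (RatFunc.X : RatFunc ℚ) ^ (2 * i + 1 : ℕ)) :=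
    Finset.prod_congr rfl fun i _ => by congr 2
  have e2 : ∏ i : Fin n, ∏ j ∈ Finset.Ioi i,
        (1 - (RatFunc.X : RatFunc ℚ) ^ (2 * (i + 1 + (j + 1) - 1) : ℕ)) =
      ∏ i : Fin n, ∏ j ∈ Finset.Ioi i, (1 - (RatFunc.X : RatFunc ℚ) ^ (2 * (i + j + 1) : ℕ)) :=
    Finset.prod_congr rfl fun i _ => Finset.prod_congr rfl fun j _ => by congr 3; omega
  rw [e1, e2, mul_div_cancel_right₀]
  refine mul_ne_zero (Finset.prod_ne_zero_iff.2 fun i _ => ?_)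
    (Finset.prod_ne_zero_iff.2 fun i _ => Finset.prod_ne_zero_iff.2 fun j _ => ?_)
  · exact sub_ne_zero.2 (RatFunc_X_pow_ne_one (by omega)).symm
  · exact sub_ne_zero.2 (RatFunc_X_pow_ne_one (by omega)).symm
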